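/- Let $[T]$ be a finite universe of tokens. Queries $q=(q_1,\dots,q_{\mathrm{len}(q)})$ and documents $d=(d_1,\dots,d_{\mathrm{len}(d)})$ are nonempty finite sequences of tokens. Every token $t$ occurring in a query $q$ has a unit-norm embedding $E_q(t)\in\mathbb{R}^m$, and every position $j$ of a document $d$ has a unit-norm embedding $E_d(d_j)\in\mathbb{R}^m$ (embeddings may depend on the whole query or document). For a pair $(q,d)$ let $x_{(q,d)}\in\mathbb{R}^T$ be the vector with $x_{(q,d)}(t)=\max_{1\le j\le \mathrm{len}(d)} E_q(t)^\top E_d(d_j)$ if $t$ occurs in $q$, and $x_{(q,d)}(t)=0$ otherwise. The Weighted Chamfer score of $(q,d)$ under weights $w\in\mathbb{R}^T$ is $\langle w,x_{(q,d)}\rangle$. There is a universal constant $C>0$ such that the following holds for all $T$, $m$ and all such embeddings. Let $\mathfrak D$ be a probability distribution on query–document pairs, let $$A=\mathbb{E}_{(q,d)\sim\mathfrak D}\Big[\tfrac{1}{\mathrm{len}(q)}\,x_{(q,d)}x_{(q,d)}^\top\Big],$$ and suppose $\lambda_{\min}(A)>0$. Let $w_*\in\mathbb{R}^T$, $\delta\in(0,1)$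 and $$n\ \ge\ C\,\frac{1}{\lambda_{\min}(A)}\log\frac{T}{\delta}.$$ Draw $(q^{(1)},d^{(1)}),\dots,(q^{(n)},d^{(n)})$ i.i.d. from $\mathfrak D$, let $X\in\mathbb{R}^{n\times T}$ be the matrix with rows $x_{(q^{(k)},d^{(k)})}$, and let $s=Xw_*$ be the vector of observed Weighted Chamfer scores. Then, with probability at least $1-\delta$, the matrix $X^\top X$ is invertible and the algorithm that outputs $(X^\top X)^{-1}X^\top s$ recovers the hidden weights exactly: $(X^\top X)^{-1}X^\top s=w_*$. Moreover, on the same event, if no sampled query contains a repeated token, the weights are likewise recovered from the length-normalized scores $$\eta_k=\frac{1}{\mathrm{len}(q^{(k)})}\sum_{i=1}^{\mathrm{len}(q^{(k)})} (w_*)_{q^{(k)}_i}\,\max_{j} E_{q^{(k)}}(q^{(k)}_i)^\top E_{d^{(k)}}(d^{(k)}_j),$$ namely by the same algorithm run on $s_k=\mathrm{len}(q^{(k)})\,\eta_k$. -/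

import Mathlib

open scoped Matrix

noncomputable section

namespace Chamfer

/-- A query or a document: a nonempty finite sequence of tokens from the universe `Fin T`. -/
structure TokenSeq (T : ℕ) where
  tokens : List (Fin T)
  nonempty : tokens ≠ []

/-- The number of tokens. -/
def TokenSeq.len {T : ℕ} (q : TokenSeq T) : ℕ := q.tokens.length

/-- Token sequences form a countable set; every subset of it is an event. -/
instance (T : ℕ) : MeasurableSpace (TokenSeq T) := ⊤

instance (T : ℕ) : DiscreteMeasurableSpace (TokenSeq T) := ⟨fun _ => trivial⟩

instance (T : ℕ) : Countable (TokenSeq T) :=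
  Function.Injective.countable (f := TokenSeq.tokens) (by
    rintro ⟨a, _⟩ ⟨b, _⟩ h
    cases h
    rfl)

/-- A query encoder: `EQ q t` is the embedding of the token `t` in the query `q`
(it may depend on the whole query; only the values with `t ∈ q` matter). -/
abbrev QueryEncoder (T m : ℕ) := TokenSeq T → Fin T → EuclideanSpace ℝ (Fin m)

/-- A document encoder: `ED d j` is the embedding of the `j`-th token of the document `d`
(it may depend on the whole document). -/
abbrev DocEncoder (T m : ℕ) := (d : TokenSeq T) → Fin d.len → EuclideanSpace ℝ (Fin m)

/-- The embeddings of the tokens of queries are unit vectors. -/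
def QueryEncoder.UnitNorm {T m : ℕ} (EQ : QueryEncoder T m) : Prop :=
  ∀ q : TokenSeq T, ∀ t ∈ q.tokens, ‖EQ q t‖ = 1

/-- The embeddings of the tokens of documents are unit vectors. -/
def DocEncoder.UnitNorm {T m : ℕ} (ED : DocEncoder T m) : Prop :=
  ∀ (d : TokenSeq T) (j : Fin d.len), ‖ED d j‖ = 1

variable {T m n : ℕ}

/-- `max_j ⟨E_q(t), E_d(d_j)⟩`, the maximum being over the positions of the document `d`. -/
def maxSim (EQ : QueryEncoder T m) (ED : DocEncoder T m) (q d : TokenSeq T) (t : Fin T) : ℝ :=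
  ⨆ j : Fin d.len, inner ℝ (EQ q t) (ED d j)

/-- The vector `x_{(q,d)} ∈ ℝ^T`, for the pair `z = (q, d)`. -/
def feature (EQ : QueryEncoder T m) (ED : DocEncoder T m) (z : TokenSeq T × TokenSeq T) :
    Fin T → ℝ :=
  fun t => if t ∈ z.1.tokens then maxSim EQ ED z.1 z.2 t else 0

/-- The Weighted Chamfer score `⟨w, x_{(q,d)}⟩`. -/
def score (EQ : QueryEncoder T m) (ED : DocEncoder T m) (w : Fin T → ℝ)
    (z : TokenSeq T × TokenSeq T) : ℝ :=
  w ⬝ᵥ feature EQ ED z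

/-- The length-normalized Weighted Chamfer score
`(1 / len q) ∑_i w_{q_i} max_j ⟨E_q(q_i), E_d(d_j)⟩`, summed over the positions of the query. -/
def normalizedScore (EQ : QueryEncoder T m) (ED : DocEncoder T m) (w : Fin T → ℝ)
    (z : TokenSeq T × TokenSeq T) : ℝ :=
  (1 / (z.1.len : ℝ)) *
    ∑ i : Fin z.1.len, w (z.1.tokens.get i) * maxSim EQ ED z.1 z.2 (z.1.tokens.get i)

/-- `A = E_{(q,d) ∼ D} [(1 / len q) x xᵀ]`. -/
def populationMatrix (EQ : QueryEncoder T m) (ED : DocEncoder T m)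
    (D : MeasureTheory.Measure (TokenSeq T × TokenSeq T)) : Matrix (Fin T) (Fin T) ℝ :=
  Matrix.of fun s t => ∫ z, (1 / (z.1.len : ℝ)) * (feature EQ ED z s * feature EQ ED z t) ∂D

/-- The smallest eigenvalue of a real symmetric matrix. -/
def lambdaMin (A : Matrix (Fin T) (Fin T) ℝ) : ℝ := sInf (spectrum ℝ A)

/-- The data matrix `X ∈ ℝ^{n × T}`, whose rows are the vectors `x_{(q,d)}` of the samples. -/
def dataMatrix (EQ : QueryEncoder T m) (ED : DocEncoder T m)
    (z : Fin n → TokenSeq T × TokenSeq T) : Matrix (Fin n) (Fin T) ℝ :=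
  Matrix.of fun k => feature EQ ED (z k)

/-- The learning algorithm: from the observed pairs `z` and numbers `s` it returns
`(XᵀX)⁻¹ Xᵀ s`. It has access to nothing else (besides the known encoders). -/
def learnWeights (EQ : QueryEncoder T m) (ED : DocEncoder T m)
    (z : Fin n → TokenSeq T × TokenSeq T) (s : Fin n → ℝ) : Fin T → ℝ :=
  ((dataMatrix EQ ED z)ᵀ * dataMatrix EQ ED z)⁻¹ *ᵥ ((dataMatrix EQ ED z)ᵀ *ᵥ s)

end Chamfer

end

/-!
Each sample lowers the codimension of the span `V` of the earlier feature vectors by one unless its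
own feature vector lies in `V`. For `(q, d) ∼ D` the feature vector `x` has at most `len q` nonzero
entries, all in `[-1, 1]`, so by Bessel's inequality the squared coordinates of `x` along an
orthonormal basis of `Vᗮ` sum to at most `len q`, and to `0` when `x ∈ V`. Dividing by `len q` and
taking expectations, `λ_min(A) * dim Vᗮ ≤ P(x ∉ V)`. Hence every sample shrinks the expected
codimension by a factor at most `1 - λ_min(A) ≤ exp (-λ_min(A))`, and by Markov's inequality `n`
samples fail to span `ℝ^T` with probability at most `T * exp (-n * λ_min(A))`. No matrix
concentration inequality is needed.
-/

open MeasureTheory Module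

namespace Chamfer

section Codimension

variable {K E : Type*} [DivisionRing K] [AddCommGroup E] [Module K E]

/-- The codimension of a subspace, which measures how far random vectors are from spanning the
whole space; like `finrank`, it is `0` when infinite. -/
noncomputable def codim (V : Submodule K E) : ℕ := finrank K (E ⧸ V)

lemma codim_bot : codim (⊥ : Submodule K E) = finrank K E :=
  (Submodule.quotEquivOfEqBot ⊥ rfl).finrank_eq

variable [FiniteDimensional K E]

lemma codim_add_finrank (V : Submodule K E) : codim V + finrank K V = finrank K E :=
  V.finrank_quotient_add_finrank

lemma codim_pos {V : Submodule K E} : 0 < codim V ↔ V ≠ ⊤ := by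
  rw [codim, finrank_pos_iff, Submodule.Quotient.nontrivial_iff]

lemma codim_sup_span_singleton_add_one {V : Submodule K E} {v : E} (hv : v ∉ V) :
    codim (V ⊔ Submodule.span K {v}) + 1 = codim V := by
  have hsup := codim_add_finrank (V ⊔ Submodule.span K {v})
  rw [Submodule.finrank_sup_span_singleton hv] at hsup
  have := codim_add_finrank V
  omega

lemma codim_sup_span_singleton_eq_sub_indicator {α : Type*} (x : α → E) (V : Submodule K E)
    (a : α) :
    (codim (V ⊔ Submodule.span K {x a}) : ℝ) = codim V - {a | x a ∉ V}.indicator 1 a := by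
  by_cases ha : x a ∈ V
  · simp [ha]
  · simp [ha, ← codim_sup_span_singleton_add_one ha]

end Codimension

lemma codim_eq_finrank_orthogonal {𝕜 E : Type*} [RCLike 𝕜] [NormedAddCommGroup E]
    [InnerProductSpace 𝕜 E] [FiniteDimensional 𝕜 E] (V : Submodule 𝕜 E) :
    codim V = finrank 𝕜 Vᗮ := by
  have := V.finrank_add_finrank_orthogonal
  have := codim_add_finrank V
  omega

lemma integral_pi_fin_succ {α G : Type*} [NormedAddCommGroup G] [NormedSpace ℝ G]
    [MeasurableSpace α] (μ : Measure α) [SigmaFinite μ] {n : ℕ} {f : (Fin (n + 1) → α) → G}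
    (hf : Integrable f (Measure.pi fun _ => μ)) :
    ∫ z, f z ∂(Measure.pi fun _ => μ) =
      ∫ a, ∫ z, f (Fin.cons a z) ∂(Measure.pi fun _ => μ) ∂μ := by
  have hmp := (measurePreserving_piFinSuccAbove (fun _ : Fin (n + 1) => μ) 0).symm
  rw [← hmp.integral_comp']
  refine (integral_prod _ (hmp.integrable_comp_of_integrable hf)).trans ?_
  simp [MeasurableEquiv.piFinSuccAbove_symm_apply, Fin.insertNthEquiv]

section RandomSpan

variable {K E α : Type*} [DivisionRing K] [AddCommGroup E] [Module K E]

lemma span_range_comp_cons {n : ℕ} (x : α → E) (a : α) (z : Fin n → α) :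
    Submodule.span K (Set.range (x ∘ (Fin.cons a z : Fin (n + 1) → α))) =
      Submodule.span K {x a} ⊔ Submodule.span K (Set.range (x ∘ z)) := by
  rw [Set.range_comp, Fin.range_cons, Set.image_insert_eq, ← Set.range_comp,
    Submodule.span_insert]

variable [FiniteDimensional K E] [MeasurableSpace α] [DiscreteMeasurableSpace α]

lemma integrable_codim (μ : Measure α) [IsFiniteMeasure μ] (V : α → Submodule K E) :
    Integrable (fun a => (codim (V a) : ℝ)) μ :=
  .of_bound (C := finrank K E) Measurable.of_discrete.aestronglyMeasurable <| .of_forall fun a => by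
    rw [Real.norm_natCast, Nat.cast_le]
    exact (V a).finrank_quotient_le

variable (μ : Measure α) [IsProbabilityMeasure μ]

lemma integral_codim_sup_span_singleton (x : α → E) (V : Submodule K E) :
    ∫ a, (codim (V ⊔ Submodule.span K {x a}) : ℝ) ∂μ = codim V - μ.real {a | x a ∉ V} := by
  simp_rw [codim_sup_span_singleton_eq_sub_indicator]
  rw [integral_sub (integrable_const _) ((integrable_const 1).indicator .of_discrete),
    integral_indicator_one .of_discrete, integral_const, probReal_univ, one_smul]

variable [Countable α] {x : α → E} {r : ℝ}
  (hx : ∀ V : Submodule K E, r * codim V ≤ μ.real {a | x a ∉ V})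
include hx

lemma integral_codim_sup_span_range_le (n : ℕ) (V : Submodule K E) :
    ∫ z, (codim (V ⊔ Submodule.span K (Set.range (x ∘ z))) : ℝ) ∂(Measure.pi fun _ : Fin n => μ) ≤
      Real.exp (-r) ^ n * codim V := by
  induction n generalizing V with
  | zero => simp
  | succ n ih =>
    have hfirst : ∫ a, (codim (V ⊔ Submodule.span K {x a}) : ℝ) ∂μ ≤ Real.exp (-r) * codim V := by
      rw [integral_codim_sup_span_singleton]
      calc (codim V : ℝ) - μ.real {a | x a ∉ V}
          ≤ (1 - r) * codim V := by linarith [hx V]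
        _ ≤ Real.exp (-r) * codim V := by gcongr; exact Real.one_sub_le_exp_neg r
    have hpair := integrable_codim (μ.prod (Measure.pi fun _ : Fin n => μ)) fun p =>
      V ⊔ Submodule.span K {x p.1} ⊔ Submodule.span K (Set.range (x ∘ p.2))
    rw [integral_pi_fin_succ μ (integrable_codim _ _)]
    simp_rw [span_range_comp_cons, ← sup_assoc]
    calc ∫ a, ∫ z, (codim (V ⊔ Submodule.span K {x a} ⊔ Submodule.span K (Set.range (x ∘ z))) : ℝ)
          ∂(Measure.pi fun _ : Fin n => μ) ∂μ
        ≤ ∫ a, Real.exp (-r) ^ n * codim (V ⊔ Submodule.span K {x a}) ∂μ :=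
          integral_mono hpair.integral_prod_left ((integrable_codim _ _).const_mul _) fun a => ih _
      _ ≤ Real.exp (-r) ^ n * (Real.exp (-r) * codim V) := by
          rw [integral_const_mul]
          gcongr
      _ = Real.exp (-r) ^ (n + 1) * codim V := by ring

lemma measureReal_span_range_ne_top_le (n : ℕ) :
    (Measure.pi fun _ : Fin n => μ).real {z | Submodule.span K (Set.range (x ∘ z)) ≠ ⊤} ≤
      finrank K E * Real.exp (-(n * r)) := by
  have hmarkov := mul_meas_ge_le_integral_of_nonneg (.of_forall fun _ => Nat.cast_nonneg _)
    (integrable_codim (Measure.pi fun _ : Fin n => μ)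
      fun z => Submodule.span K (Set.range (x ∘ z))) 1
  have hdecay := integral_codim_sup_span_range_le μ hx n ⊥
  simp only [Nat.one_le_cast, Order.one_le_iff_pos, codim_pos] at hmarkov
  simp only [bot_sup_eq, ← Real.exp_nat_mul, mul_neg, codim_bot] at hdecay
  linarith

end RandomSpan

section MissProbability

variable {E α : Type*} [NormedAddCommGroup E] [InnerProductSpace ℝ E] {x : α → E} {c : α → ℝ}

lemma sum_mul_inner_sq_le_indicator_notMem {ι : Type*} [Fintype ι] {V : Submodule ℝ E} {e : ι → E}
    (he : Orthonormal ℝ e) (heV : ∀ i, e i ∈ Vᗮ) (hc : ∀ a, 0 ≤ c a)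
    (hcx : ∀ a, c a * ‖x a‖ ^ 2 ≤ 1) (a : α) :
    ∑ i, c a * inner ℝ (e i) (x a) ^ 2 ≤ {a | x a ∉ V}.indicator 1 a := by
  by_cases ha : x a ∈ V
  · simp [ha, fun i => Submodule.inner_left_of_mem_orthogonal ha (heV i)]
  · have hbessel : ∑ i, inner ℝ (e i) (x a) ^ 2 ≤ ‖x a‖ ^ 2 := by
      simpa using he.sum_inner_products_le (x a) (s := .univ)
    rw [Set.indicator_of_mem ha, ← Finset.mul_sum]
    exact (mul_le_mul_of_nonneg_left hbessel (hc a)).trans (hcx a)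

variable [MeasurableSpace E] [BorelSpace E] [FiniteDimensional ℝ E] [MeasurableSpace α]
  {μ : Measure α} [IsFiniteMeasure μ]

lemma integrable_mul_inner_sq (hxm : Measurable x) (hcm : Measurable c) (hc : ∀ a, 0 ≤ c a)
    (hcx : ∀ a, c a * ‖x a‖ ^ 2 ≤ 1) (v : E) :
    Integrable (fun a => c a * inner ℝ v (x a) ^ 2) μ := by
  refine .of_bound (C := ‖v‖ ^ 2) (by fun_prop) (.of_forall fun a => ?_)
  rw [Real.norm_of_nonneg (mul_nonneg (hc a) (sq_nonneg _))]
  calc c a * inner ℝ v (x a) ^ 2 ≤ c a * (‖v‖ * ‖x a‖) ^ 2 :=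
        mul_le_mul_of_nonneg_left (sq_le_sq' (neg_le_of_abs_le (abs_real_inner_le_norm v (x a)))
          (real_inner_le_norm v (x a))) (hc a)
    _ = ‖v‖ ^ 2 * (c a * ‖x a‖ ^ 2) := by ring
    _ ≤ ‖v‖ ^ 2 := mul_le_of_le_one_right (sq_nonneg _) (hcx a)

lemma mul_codim_le_measureReal_notMem (hxm : Measurable x) (hcm : Measurable c)
    (hc : ∀ a, 0 ≤ c a) (hcx : ∀ a, c a * ‖x a‖ ^ 2 ≤ 1) {r : ℝ}
    (hr : ∀ v : E, r * ‖v‖ ^ 2 ≤ ∫ a, c a * inner ℝ v (x a) ^ 2 ∂μ) (V : Submodule ℝ E) :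
    r * codim V ≤ μ.real {a | x a ∉ V} := by
  set e := stdOrthonormalBasis ℝ Vᗮ
  have he : Orthonormal ℝ fun i => (e i : E) := e.orthonormal.comp_linearIsometry Vᗮ.subtypeₗᵢ
  have hmiss : MeasurableSet {a | x a ∉ V} :=
    (hxm V.closed_of_finiteDimensional.measurableSet).compl
  have hint := fun i => integrable_mul_inner_sq (μ := μ) hxm hcm hc hcx (e i : E)
  calc r * codim V
      = ∑ i, r * ‖(e i : E)‖ ^ 2 := by
        simp [-Submodule.coe_norm, he.norm_eq_one, codim_eq_finrank_orthogonal, mul_comm]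
    _ ≤ ∑ i, ∫ a, c a * inner ℝ (e i : E) (x a) ^ 2 ∂μ := Finset.sum_le_sum fun i _ => hr _
    _ = ∫ a, ∑ i, c a * inner ℝ (e i : E) (x a) ^ 2 ∂μ :=
        (integral_finsetSum _ fun i _ => hint i).symm
    _ ≤ ∫ a, {a | x a ∉ V}.indicator 1 a ∂μ :=
        integral_mono (integrable_finsetSum _ fun i _ => hint i)
          ((integrable_const 1).indicator hmiss)
          (sum_mul_inner_sq_le_indicator_notMem he (fun i => (e i).2) hc hcx)
    _ = μ.real {a | x a ∉ V} := integral_indicator_one hmiss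

end MissProbability

section LeastSquares

variable {ι κ : Type*} [Fintype ι] [Fintype κ] [DecidableEq ι]

lemma isUnit_transpose_mul_self_of_span_row_eq_top {F : Type*} [Field F] [LinearOrder F]
    [IsStrictOrderedRing F] {X : Matrix κ ι F} (hX : Submodule.span F (Set.range X.row) = ⊤) :
    IsUnit (Xᵀ * X) := by
  have hrank : (Xᵀ * X).rank = finrank F (ι → F) := by
    rw [Matrix.rank_transpose_mul_self, Matrix.rank_eq_finrank_span_row, hX, finrank_top]
  rw [← Matrix.mulVec_surjective_iff_isUnit]
  exact LinearMap.range_eq_top.1 (Submodule.eq_top_of_finrank_eq hrank)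

lemma inv_transpose_mul_self_mulVec_transpose_mulVec {R : Type*} [CommRing R] {X : Matrix κ ι R}
    (hX : IsUnit (Xᵀ * X)) (w : ι → R) : (Xᵀ * X)⁻¹ *ᵥ (Xᵀ *ᵥ (X *ᵥ w)) = w := by
  rw [Matrix.mulVec_mulVec, Matrix.mulVec_mulVec, Matrix.mul_assoc,
    Matrix.nonsing_inv_mul _ ((Matrix.isUnit_iff_isUnit_det _).1 hX), Matrix.one_mulVec]

end LeastSquares

section SecondMoment

variable {ι : Type*}

open scoped MatrixOrder in
lemma sInf_spectrum_mul_dotProduct_self_le [Fintype ι] [DecidableEq ι] {A : Matrix ι ι ℝ}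
    (hA : A.IsHermitian) (v : ι → ℝ) : sInf (spectrum ℝ A) * (v ⬝ᵥ v) ≤ v ⬝ᵥ A *ᵥ v := by
  have hle : algebraMap ℝ (Matrix ι ι ℝ) (sInf (spectrum ℝ A)) ≤ A :=
    algebraMap_le_of_le_spectrum (fun _ ht => csInf_le A.finite_spectrum.bddBelow ht)
      hA.isSelfAdjoint
  have h := (Matrix.le_iff.1 hle).dotProduct_mulVec_nonneg v
  simpa [Matrix.sub_mulVec, Algebra.algebraMap_eq_smul_one, Matrix.smul_mulVec] using h

variable {α : Type*} [MeasurableSpace α]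

/-- The matrix `∫ c x xᵀ ∂μ` of weighted second moments of a random vector `x`, of which the
population matrix is the case `c = 1 / len q`. Entries that are not integrable are `0`. -/
noncomputable def secondMoment (μ : Measure α) (c : α → ℝ) (x : α → ι → ℝ) : Matrix ι ι ℝ :=
  Matrix.of fun s t => ∫ a, c a * (x a s * x a t) ∂μ

variable {μ : Measure α} {c : α → ℝ} {x : α → ι → ℝ}

lemma isHermitian_secondMoment : (secondMoment μ c x).IsHermitian := by
  ext s t
  simp [secondMoment, mul_comm]

variable [Fintype ι]

lemma dotProduct_secondMoment_mulVec
    (hint : ∀ s t, Integrable (fun a => c a * (x a s * x a t)) μ) (v : ι → ℝ) :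
    v ⬝ᵥ secondMoment μ c x *ᵥ v = ∫ a, c a * (v ⬝ᵥ x a) ^ 2 ∂μ := by
  have hexpand : ∀ a, c a * (v ⬝ᵥ x a) ^ 2 =
      ∑ s, ∑ t, v s * (c a * (x a s * x a t) * v t) := fun a => by
    rw [dotProduct, sq, Finset.sum_mul_sum, Finset.mul_sum]
    refine Finset.sum_congr rfl fun s _ => ?_
    rw [Finset.mul_sum]
    exact Finset.sum_congr rfl fun t _ => by ring
  have hint' := fun s t => ((hint s t).mul_const (v t)).const_mul (v s)
  simp_rw [hexpand]
  rw [integral_finsetSum _ fun s _ => integrable_finsetSum _ fun t _ => hint' s t]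
  simp_rw [integral_finsetSum _ fun t _ => hint' _ t, integral_const_mul, integral_mul_const,
    dotProduct, Matrix.mulVec, dotProduct, secondMoment, Matrix.of_apply, Finset.mul_sum]

variable [DiscreteMeasurableSpace α] (hc : ∀ a, 0 ≤ c a) (hcx : ∀ a, c a * (x a ⬝ᵥ x a) ≤ 1)
include hc hcx

lemma integrable_mul_apply_mul_apply [IsFiniteMeasure μ] (s t : ι) :
    Integrable (fun a => c a * (x a s * x a t)) μ := by
  refine .of_bound (C := 1) Measurable.of_discrete.aestronglyMeasurable (.of_forall fun a => ?_)
  have hsq : ∀ i, x a i ^ 2 ≤ x a ⬝ᵥ x a := fun i => by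
    simpa [dotProduct, sq] using
      Finset.single_le_sum (fun j _ => mul_self_nonneg (x a j)) (Finset.mem_univ i)
  have habs : |x a s * x a t| ≤ x a ⬝ᵥ x a := by
    rw [abs_le]
    constructor <;> nlinarith [hsq s, hsq t, sq_nonneg (x a s - x a t), sq_nonneg (x a s + x a t)]
  rw [Real.norm_eq_abs, abs_mul, abs_of_nonneg (hc a)]
  exact (mul_le_mul_of_nonneg_left habs (hc a)).trans (hcx a)

variable [DecidableEq ι]

lemma sInf_spectrum_secondMoment_mul_codim_le [IsFiniteMeasure μ]
    (V : Submodule ℝ (EuclideanSpace ℝ ι)) :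
    sInf (spectrum ℝ (secondMoment μ c x)) * codim V ≤ μ.real {a | WithLp.toLp 2 (x a) ∉ V} := by
  have hnorm : ∀ v : EuclideanSpace ℝ ι, ‖v‖ ^ 2 = v.ofLp ⬝ᵥ v.ofLp := fun v => by
    rw [EuclideanSpace.real_norm_sq_eq, dotProduct]
    simp only [sq]
  refine mul_codim_le_measureReal_notMem .of_discrete .of_discrete hc
    (fun a => (hnorm _).symm ▸ hcx a) (fun v => ?_) V
  rw [hnorm]
  refine (sInf_spectrum_mul_dotProduct_self_le isHermitian_secondMoment v.ofLp).trans_eq ?_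
  rw [dotProduct_secondMoment_mulVec (integrable_mul_apply_mul_apply hc hcx)]
  simp [EuclideanSpace.inner_eq_star_dotProduct, dotProduct_comm]

lemma measureReal_not_isUnit_transpose_mul_self_le [Countable α] [IsProbabilityMeasure μ] (n : ℕ) :
    (Measure.pi fun _ : Fin n => μ).real
        {z | ¬ IsUnit ((Matrix.of (x ∘ z))ᵀ * Matrix.of (x ∘ z))} ≤
      Fintype.card ι * Real.exp (-(n * sInf (spectrum ℝ (secondMoment μ c x)))) := by
  have hsubset : {z : Fin n → α | ¬ IsUnit ((Matrix.of (x ∘ z))ᵀ * Matrix.of (x ∘ z))} ⊆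
      {z | Submodule.span ℝ (Set.range ((fun a => WithLp.toLp 2 (x a)) ∘ z)) ≠ ⊤} := by
    refine fun z hz hspan => hz (isUnit_transpose_mul_self_of_span_row_eq_top ?_)
    have hmap := congrArg (Submodule.map (WithLp.linearEquiv 2 ℝ (ι → ℝ)).toLinearMap) hspan
    rwa [Submodule.map_span, ← Set.range_comp, Submodule.map_top, LinearEquiv.range] at hmap
  rw [← finrank_euclideanSpace (𝕜 := ℝ)]
  exact (measureReal_mono hsubset).trans
    (measureReal_span_range_ne_top_le μ (sInf_spectrum_secondMoment_mul_codim_le hc hcx) n)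

end SecondMoment

lemma mul_exp_neg_le_of_log_div_le {a b δ : ℝ} (hδ : 0 < δ) (h : Real.log (a / δ) ≤ b) :
    a * Real.exp (-b) ≤ δ := by
  have := (Real.le_exp_log (a / δ)).trans (Real.exp_le_exp.2 h)
  rwa [Real.exp_neg, mul_inv_le_iff₀ (Real.exp_pos b), ← div_le_iff₀' hδ]

section Features

variable {T m n : ℕ} {EQ : QueryEncoder T m} {ED : DocEncoder T m}

lemma TokenSeq.len_pos (q : TokenSeq T) : 0 < q.len :=
  List.length_pos_iff.2 q.nonempty

lemma abs_maxSim_le_one {q d : TokenSeq T} {t : Fin T} (hQ : ‖EQ q t‖ ≤ 1)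
    (hD : ∀ j, ‖ED d j‖ ≤ 1) : |maxSim EQ ED q d t| ≤ 1 := by
  have hinner : ∀ j, |inner ℝ (EQ q t) (ED d j)| ≤ 1 := fun j =>
    (abs_real_inner_le_norm _ _).trans (mul_le_one₀ hQ (norm_nonneg _) (hD j))
  have : Nonempty (Fin d.len) := ⟨⟨0, d.len_pos⟩⟩
  obtain ⟨j, hj⟩ := exists_eq_ciSup_of_finite (f := fun j => inner ℝ (EQ q t) (ED d j))
  rw [maxSim, ← hj]
  exact hinner j

lemma feature_dotProduct_self_le_len {z : TokenSeq T × TokenSeq T}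
    (hQ : ∀ t ∈ z.1.tokens, ‖EQ z.1 t‖ ≤ 1) (hD : ∀ j, ‖ED z.2 j‖ ≤ 1) :
    feature EQ ED z ⬝ᵥ feature EQ ED z ≤ z.1.len := by
  calc feature EQ ED z ⬝ᵥ feature EQ ED z
      = ∑ t ∈ z.1.tokens.toFinset, maxSim EQ ED z.1 z.2 t ^ 2 := by
        simp [dotProduct, feature, sq, ← List.mem_toFinset]
    _ ≤ ∑ t ∈ z.1.tokens.toFinset, 1 := Finset.sum_le_sum fun t ht =>
        (sq_le_one_iff_abs_le_one _).2 (abs_maxSim_le_one (hQ t (List.mem_toFinset.1 ht)) hD)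
    _ ≤ z.1.len := by
        rw [Finset.sum_const, nsmul_one, Nat.cast_le]
        exact List.toFinset_card_le _

lemma measureReal_not_isUnit_gram_le (hQ : ∀ q, ∀ t ∈ q.tokens, ‖EQ q t‖ ≤ 1)
    (hD : ∀ d j, ‖ED d j‖ ≤ 1) (D : Measure (TokenSeq T × TokenSeq T)) [IsProbabilityMeasure D]
    (n : ℕ) :
    (Measure.pi fun _ : Fin n => D).real
        {z | ¬ IsUnit ((dataMatrix EQ ED z)ᵀ * dataMatrix EQ ED z)} ≤
      T * Real.exp (-(n * lambdaMin (populationMatrix EQ ED D))) := by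
  have hweight : ∀ z : TokenSeq T × TokenSeq T,
      1 / (z.1.len : ℝ) * (feature EQ ED z ⬝ᵥ feature EQ ED z) ≤ 1 := fun z => by
    rw [one_div_mul_eq_div]
    exact div_le_one_of_le₀ (feature_dotProduct_self_le_len (hQ z.1) (hD z.2)) (Nat.cast_nonneg _)
  have h := measureReal_not_isUnit_transpose_mul_self_le (μ := D) (fun _ => by positivity) hweight n
  rwa [Fintype.card_fin] at h

lemma learnWeights_score {z : Fin n → TokenSeq T × TokenSeq T}
    (hz : IsUnit ((dataMatrix EQ ED z)ᵀ * dataMatrix EQ ED z)) (w : Fin T → ℝ) :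
    learnWeights EQ ED z (fun k => score EQ ED w (z k)) = w := by
  have hscore : (fun k => score EQ ED w (z k)) = dataMatrix EQ ED z *ᵥ w :=
    funext fun _ => dotProduct_comm _ _
  rw [learnWeights, hscore, inv_transpose_mul_self_mulVec_transpose_mulVec hz]

lemma len_mul_normalizedScore (w : Fin T → ℝ) {z : TokenSeq T × TokenSeq T}
    (hz : z.1.tokens.Nodup) : z.1.len * normalizedScore EQ ED w z = score EQ ED w z := by
  have hlen : (z.1.len : ℝ) ≠ 0 := Nat.cast_ne_zero.2 z.1.len_pos.ne'
  calc z.1.len * normalizedScore EQ ED w z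
      = ∑ i : Fin z.1.len, w (z.1.tokens.get i) * maxSim EQ ED z.1 z.2 (z.1.tokens.get i) := by
        rw [normalizedScore, ← mul_assoc, mul_one_div_cancel hlen, one_mul]
    _ = ∑ t ∈ z.1.tokens.toFinset, w t * maxSim EQ ED z.1 z.2 t := by
        rw [List.sum_toFinset _ hz]
        exact Fin.sum_univ_fun_getElem z.1.tokens fun t => w t * maxSim EQ ED z.1 z.2 t
    _ = score EQ ED w z := by
        simp [score, dotProduct, feature, ← List.mem_toFinset]

end Features

end Chamfer

theorem mainTheorem3_general {T m : ℕ} {EQ : Chamfer.QueryEncoder T m}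
    {ED : Chamfer.DocEncoder T m} (hQ : ∀ q, ∀ t ∈ q.tokens, ‖EQ q t‖ ≤ 1)
    (hD : ∀ d j, ‖ED d j‖ ≤ 1) (D : Measure (Chamfer.TokenSeq T × Chamfer.TokenSeq T))
    [IsProbabilityMeasure D] (hlam : 0 < Chamfer.lambdaMin (Chamfer.populationMatrix EQ ED D))
    {δ : ℝ} (hδ : 0 < δ) {n : ℕ}
    (hn : 1 / Chamfer.lambdaMin (Chamfer.populationMatrix EQ ED D) * Real.log (T / δ) ≤ n) :
    1 - δ ≤ (Measure.pi fun _ : Fin n => D).real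
      {z | IsUnit ((Chamfer.dataMatrix EQ ED z)ᵀ * Chamfer.dataMatrix EQ ED z) ∧
        ∀ w : Fin T → ℝ,
          Chamfer.learnWeights EQ ED z (fun k => Chamfer.score EQ ED w (z k)) = w ∧
          ((∀ k, (z k).1.tokens.Nodup) →
            Chamfer.learnWeights EQ ED z
              (fun k => (z k).1.len * Chamfer.normalizedScore EQ ED w (z k)) = w)} := by
  set singular := {z : Fin n → Chamfer.TokenSeq T × Chamfer.TokenSeq T |
    ¬ IsUnit ((Chamfer.dataMatrix EQ ED z)ᵀ * Chamfer.dataMatrix EQ ED z)}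
  have hlog : Real.log (T / δ) ≤ n * Chamfer.lambdaMin (Chamfer.populationMatrix EQ ED D) := by
    rwa [one_div_mul_eq_div, div_le_iff₀ hlam] at hn
  have hsingular : (Measure.pi fun _ : Fin n => D).real singular ≤ δ :=
    (Chamfer.measureReal_not_isUnit_gram_le hQ hD D n).trans
      (Chamfer.mul_exp_neg_le_of_log_div_le hδ hlog)
  calc 1 - δ ≤ 1 - (Measure.pi fun _ : Fin n => D).real singular := by gcongr
    _ = (Measure.pi fun _ : Fin n => D).real singularᶜ :=
        (probReal_compl_eq_one_sub .of_discrete).symm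
    _ ≤ _ := measureReal_mono fun z hz => ?_
  have hunit := not_not.1 hz
  refine ⟨hunit, fun w => ⟨Chamfer.learnWeights_score hunit w, fun hnodup => ?_⟩⟩
  simp_rw [Chamfer.len_mul_normalizedScore w (hnodup _)]
  exact Chamfer.learnWeights_score hunit w

theorem mainTheorem3 :
    ∃ C : ℝ, 0 < C ∧
      ∀ (T m : ℕ) (EQ : Chamfer.QueryEncoder T m) (ED : Chamfer.DocEncoder T m),
        EQ.UnitNorm → ED.UnitNorm →
      ∀ (D : MeasureTheory.Measure (Chamfer.TokenSeq T × Chamfer.TokenSeq T))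
        [MeasureTheory.IsProbabilityMeasure D],
        0 < Chamfer.lambdaMin (Chamfer.populationMatrix EQ ED D) →
      ∀ (w : Fin T → ℝ) (δ : ℝ), 0 < δ → δ < 1 →
      ∀ n : ℕ,
        C * (1 / Chamfer.lambdaMin (Chamfer.populationMatrix EQ ED D) * Real.log (T / δ)) ≤ n →
        1 - δ ≤ (MeasureTheory.Measure.pi fun _ : Fin n => D).real
          {z | IsUnit ((Chamfer.dataMatrix EQ ED z)ᵀ * Chamfer.dataMatrix EQ ED z) ∧
            Chamfer.learnWeights EQ ED z (fun k => Chamfer.score EQ ED w (z k)) = w ∧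
            ((∀ k, (z k).1.tokens.Nodup) →
              Chamfer.learnWeights EQ ED z
                (fun k => (z k).1.len * Chamfer.normalizedScore EQ ED w (z k)) = w)} := by
  refine ⟨1, one_pos, fun T m EQ ED hQ hD D _ hlam w δ hδ _ n hn => ?_⟩
  exact (mainTheorem3_general (fun q t ht => (hQ q t ht).le) (fun d j => (hD d j).le) D hlam hδ
    (by rwa [one_mul] at hn)).trans (measureReal_mono fun z hz => ⟨hz.1, hz.2 w⟩)
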